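/- **Conventions.** A *computational problem* $\mathcal P=(\Xi,\Omega,(\mathcal M,d),\Lambda)$ consists of an input class $\Omega$, a metric space $(\mathcal M,d)$, a target map $\Xi:\Omega\to\mathcal M$ and a set $\Lambda$ of functions $\Omega\to\mathbb C$ (evaluations) such that $\Xi(A)\neq\Xi(B)$ implies $f(A)\ne f(B)$ for some $f\in\Lambda$. A *general algorithm* on $\mathcal P$ is a map $\Gamma:\Omega\to\mathcal M$ together with a map $\Lambda_\Gamma$ from $\Omega$ to the finite nonempty subsets of $\Lambda$ such that, for all $A,B\in\Omega$, if $f(B)=f(A)$ for every $f\in\Lambda_\Gamma(A)$, then $\Gamma(B)=\Gamma(A)$ and $\Lambda_\Gamma(B)=\Lambda_\Gamma(A)$. A *type-$G$ tower of height $0$* for $\Xi$ is a general algorithm with $\Gamma=\Xi$; a *type-$G$ tower of height $k\ge1$* for $\Xi$ is a family of maps $\Gamma_{n_k},\Gamma_{n_k,n_{k-1}},\dots,\Gamma_{n_k,\dots,n_1}:\Omega\to\mathcal M$, in which the maps $\Gamma_{n_k,\dots,n_1}$ with the full multi-index are general algorithms, such that for every $A\in\Omega$ $$\Xi(A)=\lim_{n_k\to\infty}\Gamma_{n_k}(A),\quad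 \Gamma_{n_k}(A)=\lim_{n_{k-1}\to\infty}\Gamma_{n_k,n_{k-1}}(A),\quad\dots,\quad \Gamma_{n_k,\dots,n_2}(A)=\lim_{n_1\to\infty}\Gamma_{n_k,\dots,n_1}(A).$$ $\operatorname{SCI}_G(\mathcal P)\in\{0,1,2,\dots,\infty\}$ is the least height of a type-$G$ tower for $\Xi$ ($\infty$ if there is none). For problems $\mathcal S=(\Psi,\Sigma,(\mathcal N,\rho),\Lambda_{\mathcal S})$ and $\mathcal P=(\Xi,\Omega,(\mathcal M,d),\Lambda_{\mathcal P})$ write $\mathcal S\le_{G,\mathrm{fq}}\mathcal P$ if there are a map $E:\Sigma\to\Omega$, a continuous map $D:\mathcal M\to\mathcal N$ with $\Psi(A)=D(\Xi(E(A)))$ for all $A\in\Sigma$, and for every $f\in\Lambda_{\mathcal P}$ an $m\ge1$, evaluations $\gamma_1,\dots,\gamma_m\in\Lambda_{\mathcal S}$ and a map $\vartheta:\operatorname{im}(\gamma_1,\dots,\gamma_m)\to\mathbb C$ with $f(E(A))=\vartheta(\gamma_1(A),\dots,\gamma_m(A))$ for all $A\in\Sigma$. **Setting.** Let $J\subset\mathbb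 R$ be a nonempty compact interval and $H=\ell^2(\mathbb N)$ with canonical basis $(e_n)$. Let $\Omega_{\mathrm{diag}}$ be the class of all (possibly unbounded) closed diagonal operators on $H$, i.e. the operators $(x_n)\mapsto(d_nx_n)$ with $(d_n)\in\mathbb C^{\mathbb N}$, on the domain $\{x\in\ell^2:(d_nx_n)\in\ell^2\}$. For $K=\{z\}$ with $z\in J$ put $r_n(K)=2^{-(n+2)}\lfloor 2^{n+2}z\rfloor$, $n\ge1$. Let $\mathcal S_J$ be the problem with inputs $(A,K)$, $A\in\Omega_{\mathrm{diag}}$, $K=\{z\}$, $z\in J$; output space $\{0,1\}$ with the discrete metric; target $(A,K)\mapsto \mathbf 1_{\{\sigma(A)\cap K=\varnothing\}}$; and evaluations $(A,K)\mapsto\langle Ae_j,e_i\rangle$ for all $i,j$ and $(A,K)\mapsto r_n(K)$ for all $n\ge1$. Let $\mathcal B_J=\{B\in\Omega_{\mathrm{diag}}:\sigma(B)\cap J=\varnothing\}$. For $B\in\mathcal B_J$ let $\mathcal P_{J,B}$ be the problem with inputs $(A\oplus B,K)$, $A\in\Omega_{\mathrm{diag}}$, $K=\{z\}$, $z\in J$,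 where $A\oplus B$ acts on $H\oplus H$; output space $\{0,1\}$ with the discrete metric; target $(T,K)\mapsto\mathbf 1_{\{\sigma(T)\cap K=\varnothing\}}$; and evaluations $(T,K)\mapsto\langle Tu_j^{(s)},u_i^{(r)}\rangle$ for all $i,j$ and $r,s\in\{1,2\}$, where $u_n^{(1)}=(e_n,0)$ and $u_n^{(2)}=(0,e_n)$, and $(T,K)\mapsto r_n(K)$ for all $n\ge1$. **Theorem.** One has $\operatorname{SCI}_G(\mathcal S_J)=2$. For every $B\in\mathcal B_J$, $$\mathcal S_J\le_{G,\mathrm{fq}}\mathcal P_{J,B},\qquad \mathcal P_{J,B}\le_{G,\mathrm{fq}}\mathcal S_J,\qquad \operatorname{SCI}_G(\mathcal P_{J,B})=2.$$ Consequently the family $(\mathcal P_{J,B})_{B\in\mathcal B_J}$ is family-pointwise exact at height $2$ ($\operatorname{SCI}_G(\mathcal P_{J,B})=2$ for all $B\in\mathcal B_J$). In particular it is witness-space sharp at height $2$ ($\operatorname{SCI}_G(\mathcal P_{J,B})\le2$ for all $B\in\mathcal B_J$, with equality for some $B\in\mathcal B_J$) and worst-case exact at height $2$ ($\sup_{B\in\mathcal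 B_J}\operatorname{SCI}_G(\mathcal P_{J,B})=2$). -/

import Mathlib

open Filter Topology

noncomputable section

namespace SCI

universe u v u' v' w

/-! ## Computational problems, towers of general algorithms, and the index `SCI_G` -/

/-- A computational problem `(Ξ, Ω, (M, d), Λ)`: an input class `Ω`, a metric output space `(M, d)`,
a target map `Ξ : Ω → M`, and a set `Λ` of complex-valued evaluation maps on `Ω` such that inputs
with different targets are distinguished by some evaluation. -/
structure CompProblem where
  Input : Type u
  Output : Type v
  [metric : MetricSpace Output]
  target : Input → Output
  evals : Set (Input → ℂ)
  consistent : ∀ A B : Input, target A ≠ target B → ∃ f ∈ evals, f A ≠ f B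

attribute [instance] CompProblem.metric

/-- A general algorithm: an output map together with a map assigning to each input a finite
nonempty set of evaluations, such that inputs which agree on the evaluations queried at `A` have
the same output and the same queries as `A`. -/
structure GeneralAlgorithm (P : CompProblem.{u, v}) where
  out : P.Input → P.Output
  queries : P.Input → Finset (P.Input → ℂ)
  queries_subset : ∀ A, (queries A : Set (P.Input → ℂ)) ⊆ P.evals
  queries_nonempty : ∀ A, (queries A).Nonempty
  determined : ∀ A B, (∀ f ∈ queries A, f B = f A) → out B = out A ∧ queries B = queries A

/-- `HasTowerFor P k F`: the map `F` is computed by a type-`G` tower of height `k`. For `k = 0`,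
`F` is the output map of one general algorithm. For height `k + 1`, `F` is the pointwise limit of
maps `G n`, each of which is computed by a tower of height `k`. Unfolding, this is a family of maps
`Γ_{n_k}, Γ_{n_k, n_{k-1}}, …, Γ_{n_k, …, n_1}` with
`F A = lim_{n_k} Γ_{n_k} A`, `Γ_{n_k} A = lim_{n_{k-1}} Γ_{n_k, n_{k-1}} A`, and so on, in which
the maps `Γ_{n_k, …, n_1}` carrying the full multi-index are general algorithms. -/
def HasTowerFor (P : CompProblem.{u, v}) : ℕ → (P.Input → P.Output) → Prop
  | 0, F => ∃ Γ : GeneralAlgorithm P, Γ.out = F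
  | k + 1, F => ∃ G : ℕ → P.Input → P.Output,
      (∀ n, HasTowerFor P k (G n)) ∧ ∀ A, Tendsto (fun n => G n A) atTop (𝓝 (F A))

/-- The type-`G` solvability complexity index: the least height of a type-`G` tower computing the
target map, and `⊤` if there is none. -/
def SCIG (P : CompProblem.{u, v}) : ℕ∞ :=
  sInf {k : ℕ∞ | ∃ m : ℕ, k = m ∧ HasTowerFor P m P.target}

/-- A family of problems is pointwise exact at `k`. -/
def FamilyPointwiseExact {ι : Type w} (𝓕 : ι → CompProblem.{u, v}) (k : ℕ) : Prop :=
  ∀ i, SCIG (𝓕 i) = k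

/-- A family of problems is witness-space sharp at `k`. -/
def WitnessSpaceSharp {ι : Type w} (𝓕 : ι → CompProblem.{u, v}) (k : ℕ) : Prop :=
  (∀ i, SCIG (𝓕 i) ≤ k) ∧ ∃ i, SCIG (𝓕 i) = k

/-- A family of problems is worst-case exact at `k`. -/
def WorstCaseExact {ι : Type w} (𝓕 : ι → CompProblem.{u, v}) (k : ℕ) : Prop :=
  ⨆ i, SCIG (𝓕 i) = k

/-- Finite-query evaluation reduction `S ≤_{G,fq} P`: an encoding `E` of inputs, a continuous
decoding `D` of outputs, and for each evaluation `f` of `P` finitely many (at least one) evaluations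
`γ` of `S` with a map `ϑ`, defined on the joint range of `γ`, that recovers the value of `f` on
encoded inputs. -/
def FQReduces (S : CompProblem.{u, v}) (P : CompProblem.{u', v'}) : Prop :=
  ∃ (E : S.Input → P.Input) (D : P.Output → S.Output), Continuous D ∧
    (∀ A, S.target A = D (P.target (E A))) ∧
    ∀ f ∈ P.evals, ∃ (m : ℕ) (_ : 1 ≤ m) (γ : Fin m → S.Input → ℂ) (_ : ∀ j, γ j ∈ S.evals)
      (ϑ : Set.range (fun (A : S.Input) (j : Fin m) => γ j A) → ℂ),
      ∀ A, f (E A) = ϑ ⟨fun j => γ j A, A, rfl⟩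

/-! ## Unbounded operators: spectrum, direct sums, diagonal operators -/

/-- The spectrum of a (possibly unbounded) operator `T` on a complex normed space: the complement
of the set of those `z` for which `T - z` has an everywhere defined bounded two-sided inverse. -/
def opSpectrum {E : Type*} [NormedAddCommGroup E] [NormedSpace ℂ E] (T : E →ₗ.[ℂ] E) : Set ℂ :=
  {z | ¬ ∃ R : E →L[ℂ] E,
      (∀ y : E, ∃ h : R y ∈ T.domain, T ⟨R y, h⟩ - z • R y = y) ∧
      ∀ x : T.domain, R (T x - z • (x : E)) = x}

/-- The direct sum `A ⊕ B` on the Hilbert sum `E ⊕ F`, with domain `D(A) ⊕ D(B)`. -/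
def directSum {E F : Type*} [NormedAddCommGroup E] [NormedSpace ℂ E]
    [NormedAddCommGroup F] [NormedSpace ℂ F] (A : E →ₗ.[ℂ] E) (B : F →ₗ.[ℂ] F) :
    WithLp 2 (E × F) →ₗ.[ℂ] WithLp 2 (E × F) where
  domain :=
    { carrier := {x | x.fst ∈ A.domain ∧ x.snd ∈ B.domain}
      add_mem' := fun hx hy => ⟨A.domain.add_mem hx.1 hy.1, B.domain.add_mem hx.2 hy.2⟩
      zero_mem' := ⟨A.domain.zero_mem, B.domain.zero_mem⟩
      smul_mem' := fun c _ hx => ⟨A.domain.smul_mem c hx.1, B.domain.smul_mem c hx.2⟩ }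
  toFun :=
    { toFun := fun x =>
        WithLp.toLp 2 (A ⟨x.1.fst, x.2.1⟩, B ⟨x.1.snd, x.2.2⟩)
      map_add' := fun x y => by
        rw [← WithLp.toLp_add, Prod.mk_add_mk, ← A.map_add, ← B.map_add]; rfl
      map_smul' := fun c x => by
        rw [RingHom.id_apply, ← WithLp.toLp_smul, Prod.smul_mk, ← A.map_smul, ← B.map_smul]; rfl }

/-- The Hilbert space `ℓ²(ℕ)`. -/
abbrev H : Type := lp (fun _ : ℕ => ℂ) 2

/-- The canonical basis vector `e n` of `ℓ²(ℕ)`. -/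
def e (n : ℕ) : H := lp.single 2 n 1

/-- The closed diagonal operator on `ℓ²(ℕ)` with diagonal `d`, on its maximal domain
`{x ∈ ℓ² | (d n * x n)ₙ ∈ ℓ²}`. -/
def diagOp (d : ℕ → ℂ) : H →ₗ.[ℂ] H where
  domain :=
    { carrier := {x | Memℓp (fun n => d n * x n) 2}
      add_mem' := fun {x y} hx hy => by
        have h : (fun n => d n * (x + y) n) = (fun n => d n * x n) + fun n => d n * y n := by
          funext n; simp [mul_add]
        exact (congrArg (fun f : ℕ → ℂ => Memℓp f 2) h).mpr (hx.add hy)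
      zero_mem' := by
        have h : (fun n => d n * (0 : H) n) = 0 := by funext n; simp
        exact (congrArg (fun f : ℕ → ℂ => Memℓp f 2) h).mpr zero_memℓp
      smul_mem' := fun c x hx => by
        have h : (fun n => d n * (c • x) n) = c • fun n => d n * x n := by
          funext n; simp [mul_left_comm]
        exact (congrArg (fun f : ℕ → ℂ => Memℓp f 2) h).mpr (hx.const_smul c) }
  toFun :=
    { toFun := fun x => ⟨fun n => d n * x.1 n, x.2⟩
      map_add' := fun x y => Subtype.ext (funext fun n => mul_add (d n) (x.1 n) (y.1 n))
      map_smul' := fun c x => Subtype.ext (funext fun n => mul_left_comm (d n) c (x.1 n)) }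

/-- The class of all (possibly unbounded, closed) diagonal operators on `ℓ²(ℕ)`. -/
def diagOperators : Set (H →ₗ.[ℂ] H) := Set.range diagOp

lemma e_mem_diagOp (d : ℕ → ℂ) (j : ℕ) : e j ∈ (diagOp d).domain := by
  change Memℓp (fun n => d n * (e j) n) 2
  have h : (fun n => d n * (e j) n) = ⇑(lp.single 2 j (d j) : H) := by
    funext n
    by_cases hn : n = j
    · subst hn; simp [e]
    · simp [e, Pi.single_eq_of_ne hn]
  rw [h]; exact lp.memℓp _

lemma e_mem (A : diagOperators) (j : ℕ) : e j ∈ A.1.domain := by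
  obtain ⟨_, d, rfl⟩ := A
  exact e_mem_diagOp d j

lemma inner_e_diagOp (d : ℕ → ℂ) (j : ℕ) (h : e j ∈ (diagOp d).domain) :
    inner ℂ (e j) (diagOp d ⟨e j, h⟩) = d j := by
  have h1 := lp.inner_single_left (𝕜 := ℂ) (G := fun _ : ℕ => ℂ) j 1 (diagOp d ⟨e j, h⟩)
  refine h1.trans ?_
  change inner ℂ (1 : ℂ) (d j * (e j) j) = d j
  simp [e]

/-! ## Singleton windows and their dyadic approximations -/

/-- The singleton windows `{z}` with `z ∈ J`, as subsets of the complex plane. -/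
def singletonWindows (J : Set ℝ) : Set (Set ℂ) := {K | ∃ z ∈ J, K = {(z : ℂ)}}

/-- The point `z` of a singleton window `{z}`. -/
def point {J : Set ℝ} (K : singletonWindows J) : ℝ := K.2.choose

lemma eq_singleton_point {J : Set ℝ} (K : singletonWindows J) : K.1 = {(point K : ℂ)} :=
  K.2.choose_spec.2

/-- The dyadic approximation `r_n({z}) = 2^{-(n+2)} ⌊2^{n+2} z⌋`. -/
def dyadic {J : Set ℝ} (n : ℕ) (K : singletonWindows J) : ℝ :=
  ⌊(2 : ℝ) ^ (n + 2) * point K⌋ / (2 : ℝ) ^ (n + 2)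

lemma abs_dyadic_sub_lt {J : Set ℝ} (n : ℕ) (K : singletonWindows J) :
    |dyadic n K - point K| < 1 / (2 : ℝ) ^ (n + 2) := by
  have h2 : (0 : ℝ) < 2 ^ (n + 2) := by positivity
  have h : dyadic n K - point K
      = (⌊(2 : ℝ) ^ (n + 2) * point K⌋ - (2 : ℝ) ^ (n + 2) * point K) / 2 ^ (n + 2) := by
    rw [dyadic]; field_simp
  rw [h, abs_div, abs_of_pos h2]
  refine div_lt_div_of_pos_right ?_ h2
  rw [abs_lt]
  constructor
  · linarith [Int.lt_floor_add_one ((2 : ℝ) ^ (n + 2) * point K)]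
  · linarith [Int.floor_le ((2 : ℝ) ^ (n + 2) * point K)]

lemma window_ext {J : Set ℝ} (K L : singletonWindows J)
    (h : ∀ n, 1 ≤ n → dyadic n K = dyadic n L) : K = L := by
  have key : ∀ M : singletonWindows J, Tendsto (fun n => dyadic n M) atTop (𝓝 (point M)) := by
    intro M
    rw [tendsto_iff_norm_sub_tendsto_zero]
    have h0 : Tendsto (fun n : ℕ => (1 / 2 : ℝ) ^ (n + 2)) atTop (𝓝 0) :=
      (tendsto_pow_atTop_nhds_zero_of_lt_one (by norm_num) (by norm_num)).comp
        (tendsto_add_atTop_nat 2)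
    refine squeeze_zero (fun n => norm_nonneg _) (fun n => ?_) h0
    have := (abs_dyadic_sub_lt n M).le
    rwa [Real.norm_eq_abs, one_div_pow]
  have hp : point K = point L :=
    tendsto_nhds_unique (key K) ((key L).congr' (by
      filter_upwards [eventually_ge_atTop 1] with n hn using (h n hn).symm))
  exact Subtype.ext (by rw [eq_singleton_point, eq_singleton_point, hp])

/-! ## The source problem and its block-diagonal stabilizations -/

/-- The discrete metric: `d(u, v) = 0` if `u = v`, and `1` otherwise. -/
@[reducible] def discreteMetric (X : Type*) [DecidableEq X] : MetricSpace X where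
  dist a b := if a = b then 0 else 1
  dist_self a := by simp
  dist_comm a b := by simp [eq_comm]
  dist_triangle a b c := by
    by_cases h1 : a = b <;> by_cases h2 : b = c <;> by_cases h3 : a = c <;> simp_all
  eq_of_dist_eq_zero {a b} h := by
    by_contra hne
    simp [hne] at h

open Classical in
/-- The decision `1_{σ(T) ∩ K = ∅}`. -/
def avoids {E : Type*} [NormedAddCommGroup E] [NormedSpace ℂ E] (T : E →ₗ.[ℂ] E) (K : Set ℂ) :
    Fin 2 :=
  if opSpectrum T ∩ K = ∅ then 1 else 0

/-- The matrix-entry evaluation `μ_{i,j}(A, K) = ⟨A e_j, e_i⟩`. -/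
def entryEval (J : Set ℝ) (i j : ℕ) : diagOperators × singletonWindows J → ℂ :=
  fun x => inner ℂ (e i) (x.1.1 ⟨e j, e_mem x.1 j⟩)

/-- The window evaluation `ρ_n(A, K) = r_n(K)`. -/
def windowEval (X : Type*) (J : Set ℝ) (n : ℕ) : X × singletonWindows J → ℂ :=
  fun x => (dyadic n x.2 : ℂ)

lemma diagOperators_ext (A B : diagOperators)
    (h : ∀ j, inner ℂ (e j) (A.1 ⟨e j, e_mem A j⟩) = inner ℂ (e j) (B.1 ⟨e j, e_mem B j⟩)) :
    A = B := by
  obtain ⟨_, d, rfl⟩ := A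
  obtain ⟨_, d', rfl⟩ := B
  have : d = d' := by
    funext j
    have := h j
    rwa [inner_e_diagOp, inner_e_diagOp] at this
  subst this; rfl

/-- The source problem: for a diagonal operator `A` and a window `K = {z}`, `z ∈ J`, decide
whether `σ(A) ∩ K = ∅`, from the matrix entries of `A` and the dyadic approximations
`r_n(K)`, `n ≥ 1`. -/
def sourceProblem (J : Set ℝ) : CompProblem.{0, 0} where
  Input := diagOperators × singletonWindows J
  Output := Fin 2
  metric := discreteMetric (Fin 2)
  target := fun x => avoids x.1.1 x.2.1
  evals := {f | ∃ i j, f = entryEval J i j} ∪ {f | ∃ n, 1 ≤ n ∧ f = windowEval _ J n}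
  consistent := by
    intro x y hxy
    by_contra! hcon
    apply hxy
    have h1 : x.1 = y.1 :=
      diagOperators_ext _ _ fun j => hcon (entryEval J j j) (Or.inl ⟨j, j, rfl⟩)
    have h2 : x.2 = y.2 := window_ext _ _ fun n hn =>
      Complex.ofReal_injective (hcon (windowEval _ J n) (Or.inr ⟨n, hn, rfl⟩))
    rw [h1, h2]

/-- The class `𝓑_J` of diagonal operators `B` with `σ(B) ∩ J = ∅`. -/
def stabilizers (J : Set ℝ) : Set (H →ₗ.[ℂ] H) :=
  {B | B ∈ diagOperators ∧ opSpectrum B ∩ (Complex.ofReal '' J) = ∅}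

/-- The basis vectors `u_n^{(1)} = (e_n, 0)` (for `r = 0`) and `u_n^{(2)} = (0, e_n)` (for `r = 1`)
of `H ⊕ H`. -/
def blockBasis (n : ℕ) (r : Fin 2) : WithLp 2 (H × H) :=
  if r = 0 then WithLp.toLp 2 (e n, 0) else WithLp.toLp 2 (0, e n)

/-- The operators `A ⊕ B` with `A` diagonal and `B` fixed. -/
def stabilizedOperators (B : H →ₗ.[ℂ] H) : Set (WithLp 2 (H × H) →ₗ.[ℂ] WithLp 2 (H × H)) :=
  {T | ∃ A ∈ diagOperators, T = directSum A B}

lemma blockBasis_mem {J : Set ℝ} (B : stabilizers J) (T : stabilizedOperators B.1) (n : ℕ)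
    (r : Fin 2) : blockBasis n r ∈ T.1.domain := by
  obtain ⟨_, A, hA, rfl⟩ := T
  change (blockBasis n r).fst ∈ A.domain ∧ (blockBasis n r).snd ∈ B.1.domain
  have hA' := e_mem ⟨A, hA⟩ n
  have hB' := e_mem ⟨B.1, B.2.1⟩ n
  unfold blockBasis
  split_ifs
  · exact ⟨hA', B.1.domain.zero_mem⟩
  · exact ⟨A.domain.zero_mem, hB'⟩

/-- The matrix-entry evaluation `ν_{(i,r),(j,s)}(T, K) = ⟨T u_j^{(s)}, u_i^{(r)}⟩`. -/
def blockEntryEval {J : Set ℝ} (B : stabilizers J) (i : ℕ) (r : Fin 2) (j : ℕ) (s : Fin 2) :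
    stabilizedOperators B.1 × singletonWindows J → ℂ :=
  fun x => inner ℂ (blockBasis i r) (x.1.1 ⟨blockBasis j s, blockBasis_mem B x.1 j s⟩)

lemma stabilizedOperators_ext {J : Set ℝ} (B : stabilizers J) (S T : stabilizedOperators B.1)
    (h : ∀ j, inner ℂ (blockBasis j 0) (S.1 ⟨blockBasis j 0, blockBasis_mem B S j 0⟩)
      = inner ℂ (blockBasis j 0) (T.1 ⟨blockBasis j 0, blockBasis_mem B T j 0⟩)) :
    S = T := by
  obtain ⟨_, A, hA, rfl⟩ := S
  obtain ⟨_, A', hA', rfl⟩ := T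
  have key : ∀ (C : H →ₗ.[ℂ] H) (hC : C ∈ diagOperators) (j : ℕ)
      (hm : blockBasis j 0 ∈ (directSum C B.1).domain),
      inner ℂ (blockBasis j 0) (directSum C B.1 ⟨blockBasis j 0, hm⟩)
        = inner ℂ (e j) (C ⟨e j, e_mem ⟨C, hC⟩ j⟩) := by
    intro C hC j hm
    rw [WithLp.prod_inner_apply]
    change inner ℂ (e j) (C ⟨e j, _⟩) + inner ℂ (0 : H) _ = _
    rw [inner_zero_left, add_zero]
  have : (⟨A, hA⟩ : diagOperators) = ⟨A', hA'⟩ := diagOperators_ext _ _ fun j => by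
    have := h j
    rwa [key A hA j, key A' hA' j] at this
  have hAA : A = A' := congrArg Subtype.val this
  subst hAA; rfl

/-- The problem stabilized by `B ∈ 𝓑_J`: for `T = A ⊕ B` with `A` diagonal and a window `K = {z}`,
`z ∈ J`, decide whether `σ(T) ∩ K = ∅`, from the matrix entries of `T` and the dyadic
approximations `r_n(K)`, `n ≥ 1`. -/
def stabilizedProblem (J : Set ℝ) (B : stabilizers J) : CompProblem.{0, 0} where
  Input := stabilizedOperators B.1 × singletonWindows J
  Output := Fin 2
  metric := discreteMetric (Fin 2)
  target := fun x => avoids x.1.1 x.2.1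
  evals := {f | ∃ i r j s, f = blockEntryEval B i r j s} ∪
    {f | ∃ n, 1 ≤ n ∧ f = windowEval _ J n}
  consistent := by
    intro x y hxy
    by_contra! hcon
    apply hxy
    have h1 : x.1 = y.1 := stabilizedOperators_ext B _ _ fun j =>
      hcon (blockEntryEval B j 0 j 0) (Or.inl ⟨j, 0, j, 0, rfl⟩)
    have h2 : x.2 = y.2 := window_ext _ _ fun n hn =>
      Complex.ofReal_injective (hcon (windowEval _ J n) (Or.inr ⟨n, hn, rfl⟩))
    rw [h1, h2]

end SCI

end

noncomputable section

namespace SCI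

universe u v u' v'

/-! ## Towers and finite-query reductions -/

/-! A point `z` lies outside the spectrum of the diagonal operator with entries `d n` exactly when
the distances `‖d n - z‖` have a positive lower bound (`notMem_opSpectrum_diagOp_iff`). This is a
statement "some `m`, all `j`: `2^{-m} ≤ ‖d j - z‖`", and each quantifier costs one limit; this gives
height two.

One limit is not enough. Outputs are discrete, so a height-one tower is a sequence of algorithms
that is eventually correct at each input, and each algorithm sees only finitely many entries at a
given input (`exists_out_eq_of_agree`). A diagonal is built in stages: continue the frozen prefix by
a constant different from `z`, wait for an algorithm to answer 1, freeze the entries it used, and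
repeat with constants tending to `z`. The resulting diagonal accumulates at `z`, yet infinitely many
algorithms answer 1 on it.

Stabilization changes nothing: every point of `J` has a bounded resolvent for `B`, so `A ⊕ B` and
`A` have the same spectrum on `J`, and the entries of `A ⊕ B` are entries of `A` or constants. Hence
the problems reduce to each other, and towers pull back along reductions
(`HasTowerFor.comp_encoding`). -/

lemma HasTowerFor.succ {P : CompProblem.{u, v}} {k : ℕ} {F : P.Input → P.Output}
    (h : HasTowerFor P k F) : HasTowerFor P (k + 1) F :=
  ⟨fun _ => F, fun _ => h, fun _ => tendsto_const_nhds⟩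

/-- Excluding height 1 also excludes height 0, since a tower lifts by a constant sequence. -/
lemma SCIG_eq_two {P : CompProblem.{u, v}} (h2 : HasTowerFor P 2 P.target)
    (h1 : ¬ HasTowerFor P 1 P.target) : SCIG P = 2 := by
  refine le_antisymm (sInf_le ⟨2, rfl, h2⟩) (le_sInf ?_)
  rintro _ ⟨m, rfl, hm⟩
  match m, hm with
  | 0, hm => exact absurd hm.succ h1
  | 1, hm => exact absurd hm h1
  | m + 2, _ => exact_mod_cast Nat.le_add_left 2 m

/-- A tower for `F` on `P` pulls back along a finite-query encoding `E` and a continuous decoding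
`D` to a tower for `D ∘ F ∘ E`. -/
lemma HasTowerFor.comp_encoding {S : CompProblem.{u, v}} {P : CompProblem.{u', v'}}
    {E : S.Input → P.Input} {D : P.Output → S.Output} (hD : Continuous D)
    (hE : ∀ f ∈ P.evals, ∃ (m : ℕ) (_ : 1 ≤ m) (γ : Fin m → S.Input → ℂ)
      (_ : ∀ j, γ j ∈ S.evals)
      (ϑ : Set.range (fun (A : S.Input) (j : Fin m) => γ j A) → ℂ),
      ∀ A, f (E A) = ϑ ⟨fun j => γ j A, A, rfl⟩)
    {k : ℕ} {F : P.Input → P.Output} (h : HasTowerFor P k F) :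
    HasTowerFor S k fun A => D (F (E A)) := by
  induction k generalizing F with
  | succ k ih =>
    obtain ⟨G, hG, hlim⟩ := h
    exact ⟨fun n A => D (G n (E A)), fun n => ih (hG n),
      fun A => (hD.tendsto _).comp (hlim (E A))⟩
  | zero =>
    classical
    obtain ⟨Γ, rfl⟩ := h
    -- The source queries `q f` depend on `f` alone, not on the input, so equal query sets of `Γ`
    -- give equal pulled-back query sets.
    have hq : ∀ f : P.Input → ℂ, ∃ q : Finset (S.Input → ℂ), f ∈ P.evals →
        (q : Set (S.Input → ℂ)) ⊆ S.evals ∧ q.Nonempty ∧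
        ∀ A B, (∀ g ∈ q, g B = g A) → f (E B) = f (E A) := by
      intro f
      by_cases hf : f ∈ P.evals
      · obtain ⟨m, hm, γ, hγ, ϑ, hϑ⟩ := hE f hf
        refine ⟨Finset.univ.image γ, fun _ => ⟨?_, ?_, fun A B hAB => ?_⟩⟩
        · rintro _ hg
          obtain ⟨j, -, rfl⟩ := Finset.mem_image.1 (Finset.mem_coe.1 hg)
          exact hγ j
        · exact ⟨γ ⟨0, hm⟩, Finset.mem_image_of_mem _ (Finset.mem_univ _)⟩
        · rw [hϑ, hϑ]
          congr 2
          funext j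
          exact hAB _ (Finset.mem_image_of_mem _ (Finset.mem_univ _))
      · exact ⟨∅, fun h => absurd h hf⟩
    choose q hq using hq
    refine ⟨{ out := fun A => D (Γ.out (E A))
              queries := fun A => (Γ.queries (E A)).biUnion q
              queries_subset := fun A g hg => ?_
              queries_nonempty := fun A => ?_
              determined := fun A B hAB => ?_ }, rfl⟩
    · obtain ⟨f, hf, hg⟩ := Finset.mem_biUnion.1 (Finset.mem_coe.1 hg)
      exact (hq f (Γ.queries_subset _ hf)).1 hg
    · obtain ⟨f, hf⟩ := Γ.queries_nonempty (E A)
      obtain ⟨g, hg⟩ := (hq f (Γ.queries_subset _ hf)).2.1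
      exact ⟨g, Finset.mem_biUnion.2 ⟨f, hf, hg⟩⟩
    · obtain ⟨h1, h2⟩ := Γ.determined (E A) (E B) fun f hf =>
        (hq f (Γ.queries_subset _ hf)).2.2 A B fun g hg =>
          hAB g (Finset.mem_biUnion.2 ⟨f, hf, hg⟩)
      exact ⟨congrArg D h1, congrArg (fun s => s.biUnion q) h2⟩

lemma FQReduces.hasTowerFor {S : CompProblem.{u, v}} {P : CompProblem.{u', v'}}
    (h : FQReduces S P) {k : ℕ} (hP : HasTowerFor P k P.target) :
    HasTowerFor S k S.target := by
  obtain ⟨E, D, hD, hT, hE⟩ := h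
  rw [show S.target = fun A => D (P.target (E A)) from funext hT]
  exact hP.comp_encoding hD hE

lemma FQReduces.SCIG_le {S : CompProblem.{u, v}} {P : CompProblem.{u', v'}}
    (h : FQReduces S P) : SCIG S ≤ SCIG P :=
  sInf_le_sInf fun _ ⟨m, hk, hm⟩ => ⟨m, hk, h.hasTowerFor hm⟩

/-- A reduction in which every evaluation of an encoded input is a function of a single evaluation
of the source problem. -/
lemma FQReduces.of_single {S : CompProblem.{u, v}} {P : CompProblem.{u', v'}}
    (E : S.Input → P.Input) (D : P.Output → S.Output) (hD : Continuous D)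
    (hT : ∀ A, S.target A = D (P.target (E A)))
    (hE : ∀ f ∈ P.evals, ∃ g ∈ S.evals, ∃ ϑ : ℂ → ℂ, ∀ A, f (E A) = ϑ (g A)) :
    FQReduces S P := by
  refine ⟨E, D, hD, hT, fun f hf => ?_⟩
  obtain ⟨g, hg, ϑ, hϑ⟩ := hE f hf
  exact ⟨1, le_rfl, fun _ => g, fun _ => hg, fun x => ϑ (x.1 0), hϑ⟩

/-! ## Spectra of diagonal operators and of direct sums -/

lemma inner_e_left (i : ℕ) (x : H) : inner ℂ (e i) x = x i := by
  refine (lp.inner_single_left (𝕜 := ℂ) (G := fun _ : ℕ => ℂ) i 1 x).trans ?_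
  simp

lemma norm_e (n : ℕ) : ‖e n‖ = 1 := by
  rw [e, lp.norm_single (by norm_num), norm_one]

lemma diagOp_e (d : ℕ → ℂ) (j : ℕ) : diagOp d ⟨e j, e_mem_diagOp d j⟩ = d j • e j := by
  ext n
  change d n * (e j) n = d j * (e j) n
  by_cases hn : n = j
  · rw [hn]
  · simp [e, Pi.single_eq_of_ne hn]

/-- A resolvent `R` applied to `(d n - z) • e n` returns `e n`, so `‖d n - z‖` cannot be smaller
than `‖R‖⁻¹`. Conversely, multiplication by `(d n - z)⁻¹` is bounded by `ε⁻¹` and is the resolvent.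
-/
lemma notMem_opSpectrum_diagOp_iff (d : ℕ → ℂ) (z : ℂ) :
    z ∉ opSpectrum (diagOp d) ↔ ∃ ε > 0, ∀ n, ε ≤ ‖d n - z‖ := by
  rw [opSpectrum, Set.mem_ofPred_eq, not_not]
  constructor
  · rintro ⟨R, -, hR⟩
    have key : ∀ n, 1 ≤ ‖R‖ * ‖d n - z‖ := fun n => by
      have h := hR ⟨e n, e_mem_diagOp d n⟩
      rw [diagOp_e, ← sub_smul, map_smul] at h
      calc 1 = ‖(d n - z) • R (e n)‖ := by rw [h, norm_e]
        _ = ‖R (e n)‖ * ‖d n - z‖ := by rw [norm_smul, mul_comm]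
        _ ≤ ‖R‖ * ‖d n - z‖ := by
          gcongr
          simpa [norm_e] using R.le_opNorm (e n)
    have hpos : 0 < ‖R‖ := by
      by_contra h
      have h0 : ‖R‖ = 0 := le_antisymm (not_lt.1 h) (norm_nonneg _)
      have := key 0
      rw [h0, zero_mul] at this
      linarith
    exact ⟨‖R‖⁻¹, inv_pos.2 hpos, fun n => (inv_le_iff_one_le_mul₀' hpos).2 (key n)⟩
  · rintro ⟨ε, hε, hd⟩
    have hne : ∀ n, d n - z ≠ 0 := fun n => norm_pos_iff.1 (hε.trans_le (hd n))
    let T : ℕ → ℂ →L[ℂ] ℂ := fun n => ContinuousLinearMap.mul ℂ ℂ (d n - z)⁻¹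
    have hT : ∀ n, ‖T n‖ ≤ ε⁻¹ := fun n => by
      rw [ContinuousLinearMap.opNorm_mul_apply, norm_inv]
      exact inv_anti₀ hε (hd n)
    let R : H →L[ℂ] H := lp.mapCLM 2 T (inv_pos.2 hε).le hT
    have hR : ∀ (y : H) (n : ℕ), R y n = (d n - z)⁻¹ * y n := fun y n => rfl
    refine ⟨R, fun y => ?_, fun x => ?_⟩
    · have hm : R y ∈ (diagOp d).domain := by
        -- The range of `R` lies in the maximal domain because `d (R y) = y + z (R y)` entrywise,
        -- which is square summable.
        have h : (fun n => d n * R y n) = ⇑(y + z • R y) := by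
          funext n
          rw [lp.coeFn_add, Pi.add_apply, lp.coeFn_smul, Pi.smul_apply, hR, smul_eq_mul]
          have := hne n
          field_simp
          ring
        change Memℓp (fun n => d n * R y n) 2
        rw [h]
        exact lp.memℓp _
      refine ⟨hm, ?_⟩
      ext n
      change d n * R y n - z * R y n = y n
      rw [hR, ← sub_mul, mul_inv_cancel_left₀ (hne n)]
    · ext n
      rw [hR]
      change (d n - z)⁻¹ * (d n * x.1 n - z * x.1 n) = x.1 n
      rw [← sub_mul, inv_mul_cancel_left₀ (hne n)]

/-- A resolvent of `A ⊕ B` compresses to one of `A` on the first summand; conversely, a resolvent of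
`A` and the given one of `B` combine blockwise. -/
lemma mem_opSpectrum_directSum_iff {E F : Type*} [NormedAddCommGroup E] [NormedSpace ℂ E]
    [NormedAddCommGroup F] [NormedSpace ℂ F] (A : E →ₗ.[ℂ] E) {B : F →ₗ.[ℂ] F} {z : ℂ}
    (hB : z ∉ opSpectrum B) : z ∈ opSpectrum (directSum A B) ↔ z ∈ opSpectrum A := by
  rw [opSpectrum, Set.mem_ofPred_eq, not_not] at hB
  obtain ⟨S, hS1, hS2⟩ := hB
  refine not_congr ⟨?_, ?_⟩
  · rintro ⟨R, hR1, hR2⟩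
    let ι : E →L[ℂ] WithLp 2 (E × F) :=
      (WithLp.prodContinuousLinearEquiv 2 ℂ E F).symm.toContinuousLinearMap.comp
        (ContinuousLinearMap.inl ℂ E F)
    refine ⟨(WithLp.fstL 2 ℂ E F).comp (R.comp ι), fun y => ?_, fun x => ?_⟩
    · obtain ⟨hm, h⟩ := hR1 (ι y)
      exact ⟨hm.1, congrArg WithLp.fst h⟩
    · have h := hR2 ⟨ι x, x.2, B.domain.zero_mem⟩
      have h' : directSum A B ⟨ι x, x.2, B.domain.zero_mem⟩ - z • ι x = ι (A x - z • (x : E)) := by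
        rw [map_sub, map_smul]
        congr 1
        change WithLp.toLp 2 (A x, B 0) = WithLp.toLp 2 (A x, 0)
        rw [B.map_zero]
      rw [h'] at h
      exact congrArg WithLp.fst h
  · rintro ⟨R, hR1, hR2⟩
    refine ⟨(WithLp.prodContinuousLinearEquiv 2 ℂ E F).symm.toContinuousLinearMap.comp
      ((R.prodMap S).comp (WithLp.prodContinuousLinearEquiv 2 ℂ E F).toContinuousLinearMap),
      fun y => ?_, fun x => ?_⟩
    · obtain ⟨hm, h⟩ := hR1 y.fst
      obtain ⟨hm', h'⟩ := hS1 y.snd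
      refine ⟨⟨hm, hm'⟩, ?_⟩
      exact WithLp.ofLp_injective 2 (Prod.ext h h')
    · have h := hR2 ⟨x.1.fst, x.2.1⟩
      have h' := hS2 ⟨x.1.snd, x.2.2⟩
      exact WithLp.ofLp_injective 2 (Prod.ext h h')

/-! ## The source problem has index two -/

lemma avoids_singleton_eq_one_iff {E : Type*} [NormedAddCommGroup E] [NormedSpace ℂ E]
    (T : E →ₗ.[ℂ] E) (z : ℂ) : avoids T {z} = 1 ↔ z ∉ opSpectrum T := by
  unfold avoids
  split_ifs with h <;> simp only [Set.inter_singleton_eq_empty, not_not] at h <;> simp [h]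

lemma avoids_congr {E F : Type*} [NormedAddCommGroup E] [NormedSpace ℂ E]
    [NormedAddCommGroup F] [NormedSpace ℂ F] {T : E →ₗ.[ℂ] E} {S : F →ₗ.[ℂ] F} {z : ℂ}
    (h : z ∈ opSpectrum T ↔ z ∈ opSpectrum S) : avoids T {z} = avoids S {z} := by
  have h' : opSpectrum T ∩ {z} = ∅ ↔ opSpectrum S ∩ {z} = ∅ := by
    simp only [Set.inter_singleton_eq_empty, h]
  exact if_congr h' rfl rfl

/-- The diagonal of a diagonal operator. -/
def diagEntries (A : diagOperators) : ℕ → ℂ := A.2.choose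

lemma diagOp_diagEntries (A : diagOperators) : diagOp (diagEntries A) = A.1 :=
  A.2.choose_spec

/-- The diagonal operator with diagonal `d`, as a member of the class. -/
def toDiag (d : ℕ → ℂ) : diagOperators := ⟨diagOp d, d, rfl⟩

lemma entryEval_toDiag (J : Set ℝ) (i j : ℕ) (d : ℕ → ℂ) (K : singletonWindows J) :
    entryEval J i j (toDiag d, K) = d j * e j i := by
  change inner ℂ (e i) (diagOp d ⟨e j, e_mem_diagOp d j⟩) = _
  rw [diagOp_e, inner_e_left]
  rfl

lemma inner_e_eq_of_eq_diagOp {T : H →ₗ.[ℂ] H} {d : ℕ → ℂ} (hT : diagOp d = T) (j : ℕ)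
    (h : e j ∈ T.domain) : inner ℂ (e j) (T ⟨e j, h⟩) = d j := by
  subst hT
  exact inner_e_diagOp d j h

lemma entryEval_self (J : Set ℝ) (j : ℕ) (x : diagOperators × singletonWindows J) :
    entryEval J j j x = diagEntries x.1 j :=
  inner_e_eq_of_eq_diagOp (diagOp_diagEntries x.1) j _

lemma diagEntries_toDiag (d : ℕ → ℂ) : diagEntries (toDiag d) = d := by
  funext j
  exact (inner_e_eq_of_eq_diagOp (diagOp_diagEntries (toDiag d)) j (e_mem_diagOp d j)).symm.trans
    (inner_e_diagOp d j (e_mem_diagOp d j))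

lemma sourceProblem_target_eq_one_iff {J : Set ℝ} (x : diagOperators × singletonWindows J) :
    (sourceProblem J).target x = (1 : Fin 2) ↔
      ∃ ε > 0, ∀ n, ε ≤ ‖diagEntries x.1 n - point x.2‖ := by
  change avoids x.1.1 x.2.1 = 1 ↔ _
  rw [eq_singleton_point x.2, avoids_singleton_eq_one_iff, ← notMem_opSpectrum_diagOp_iff,
    diagOp_diagEntries]

/-- Balls of radius 1 in the discrete metric are single points. The topology is spelled out to be
the one carried by the output space of the problems. -/
lemma eventually_eq_of_tendsto {x : ℕ → Fin 2} {y : Fin 2}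
    (h : Tendsto x atTop
      (@nhds _ (discreteMetric (Fin 2)).toUniformSpace.toTopologicalSpace y)) :
    ∀ᶠ n in atTop, x n = y := by
  let _ := discreteMetric (Fin 2)
  filter_upwards [Metric.tendsto_nhds.1 h 1 one_pos] with n hn
  by_contra hne
  change (if x n = y then (0 : ℝ) else 1) < 1 at hn
  rw [if_neg hne] at hn
  exact lt_irrefl _ hn

/-- The quantity compared with the threshold in the base algorithms: it tends to `‖d j - z‖` and
is bounded below by it. -/
def approxDist {J : Set ℝ} (x : diagOperators × singletonWindows J) (n j : ℕ) : ℝ :=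
  ‖diagEntries x.1 j - dyadic (n + 1) x.2‖ + (1 / 2) ^ (n + 3)

/-- The shift to `n + 1` respects the restriction to window evaluations of index at least 1; the
exponent is `(n + 1) + 2`. -/
lemma norm_dyadic_sub_lt {J : Set ℝ} (K : singletonWindows J) (n : ℕ) :
    ‖(dyadic (n + 1) K : ℂ) - point K‖ < (1 / 2) ^ (n + 3) := by
  rw [← Complex.ofReal_sub, Complex.norm_real, Real.norm_eq_abs, one_div_pow]
  exact abs_dyadic_sub_lt (n + 1) K

/-- The added term absorbs the window error, so the base algorithms never reject a diagonal whose
entries all pass the threshold. -/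
lemma le_approxDist {J : Set ℝ} (x : diagOperators × singletonWindows J) (n j : ℕ) :
    ‖diagEntries x.1 j - point x.2‖ ≤ approxDist x n j := by
  have h := norm_sub_le_norm_sub_add_norm_sub (diagEntries x.1 j)
    (dyadic (n + 1) x.2 : ℂ) (point x.2 : ℂ)
  exact h.trans (add_le_add_right (norm_dyadic_sub_lt x.2 n).le _)

lemma tendsto_approxDist {J : Set ℝ} (x : diagOperators × singletonWindows J) (j : ℕ) :
    Tendsto (fun n => approxDist x n j) atTop (𝓝 ‖diagEntries x.1 j - point x.2‖) := by
  have h0 : Tendsto (fun n : ℕ => (1 / 2 : ℝ) ^ (n + 3)) atTop (𝓝 0) :=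
    (tendsto_pow_atTop_nhds_zero_of_lt_one (by norm_num) (by norm_num)).comp
      (tendsto_add_atTop_nat 3)
  have h1 : Tendsto (fun n => (dyadic (n + 1) x.2 : ℂ)) atTop (𝓝 (point x.2 : ℂ)) :=
    tendsto_iff_norm_sub_tendsto_zero.2
      (squeeze_zero (fun _ => norm_nonneg _) (fun n => (norm_dyadic_sub_lt x.2 n).le) h0)
  have h2 := (((tendsto_const_nhds (x := diagEntries x.1 j)).sub h1).norm).add h0
  rwa [add_zero] at h2

open Classical in
/-- The base algorithms of the height-two tower: inspect the first `n + 1` diagonal entries. -/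
def baseAlgorithm (J : Set ℝ) (m n : ℕ) : GeneralAlgorithm (sourceProblem J) where
  out := fun x => if ∀ j ≤ n, (1 / 2) ^ m ≤ approxDist x n j then (1 : Fin 2) else (0 : Fin 2)
  queries := fun _ => insert (windowEval _ J (n + 1))
    ((Finset.range (n + 1)).image fun j => entryEval J j j)
  queries_subset := by
    intro _ f hf
    rcases Finset.mem_insert.1 (Finset.mem_coe.1 hf) with rfl | hf
    · exact Or.inr ⟨n + 1, Nat.le_add_left 1 n, rfl⟩
    · obtain ⟨j, -, rfl⟩ := Finset.mem_image.1 hf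
      exact Or.inl ⟨j, j, rfl⟩
  queries_nonempty := fun _ => Finset.insert_nonempty _ _
  determined := by
    intro x y h
    refine ⟨?_, rfl⟩
    have hw : (dyadic (n + 1) y.2 : ℂ) = dyadic (n + 1) x.2 := h _ (Finset.mem_insert_self _ _)
    have hd : ∀ j ≤ n, approxDist y n j = approxDist x n j := fun j hj => by
      have := h (entryEval J j j) (Finset.mem_insert_of_mem
        (Finset.mem_image_of_mem _ (Finset.mem_range.2 (Nat.lt_succ_of_le hj))))
      replace this : diagEntries y.1 j = diagEntries x.1 j :=
        (entryEval_self J j y).symm.trans (this.trans (entryEval_self J j x))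
      simp only [approxDist, this, hw]
    exact if_congr (forall₂_congr fun j hj => by rw [hd j hj]) rfl rfl

lemma hasTowerFor_two_sourceProblem (J : Set ℝ) :
    HasTowerFor (sourceProblem J) 2 (sourceProblem J).target := by
  classical
  refine ⟨fun m x => if ∀ j, (1 / 2 : ℝ) ^ m ≤ ‖diagEntries x.1 j - point x.2‖
    then (1 : Fin 2) else (0 : Fin 2), fun m => ⟨fun n => (baseAlgorithm J m n).out,
    fun n => ⟨baseAlgorithm J m n, rfl⟩, fun x => ?_⟩, fun x => ?_⟩
  -- Inner limit: if every entry passes, all answers are 1; otherwise a violating entry is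
  -- eventually inspected with enough precision, its distance being strictly below the threshold.
  · refine tendsto_const_nhds.congr' (EventuallyEq.symm ?_)
    by_cases h : ∀ j, (1 / 2 : ℝ) ^ m ≤ ‖diagEntries x.1 j - point x.2‖
    · refine Eventually.of_forall fun n => ?_
      exact (if_pos fun j _ => (h j).trans (le_approxDist x n j)).trans (if_pos h).symm
    · obtain ⟨j, hj⟩ := not_forall.1 h
      filter_upwards [(tendsto_approxDist x j).eventually_lt_const (not_le.1 hj),
        eventually_ge_atTop j] with n hn hjn
      exact (if_neg fun h' => (h' j hjn).not_gt hn).trans (if_neg h).symm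
  -- Outer limit: a positive gap exceeds `2^{-m}` for large `m`, while without a gap every `m` gives
  -- 0.
  · refine tendsto_const_nhds.congr' (EventuallyEq.symm ?_)
    by_cases h : (sourceProblem J).target x = (1 : Fin 2)
    · obtain ⟨ε, hε, hd⟩ := (sourceProblem_target_eq_one_iff x).1 h
      have h0 : Tendsto (fun n : ℕ => (1 / 2 : ℝ) ^ n) atTop (𝓝 0) :=
        tendsto_pow_atTop_nhds_zero_of_lt_one (by norm_num) (by norm_num)
      filter_upwards [h0.eventually_lt_const hε] with m hm
      exact (if_pos fun j => hm.le.trans (hd j)).trans h.symm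
    · refine Eventually.of_forall fun m => ?_
      have h0 : ∀ y : Fin 2, y ≠ 1 → 0 = y := by decide
      exact (if_neg fun h' => h ((sourceProblem_target_eq_one_iff x).2
        ⟨_, by positivity, h'⟩)).trans (h0 _ h)

/-- An evaluation depends on finitely many diagonal entries, once the window is fixed. -/
lemma exists_eval_eq_of_agree {J : Set ℝ} (K : singletonWindows J)
    {f : diagOperators × singletonWindows J → ℂ} (hf : f ∈ (sourceProblem J).evals) :
    ∃ N, ∀ d d' : ℕ → ℂ, (∀ j < N, d' j = d j) → f (toDiag d', K) = f (toDiag d, K) := by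
  rcases hf with ⟨i, j, rfl⟩ | ⟨n, -, rfl⟩
  · refine ⟨j + 1, fun d d' h => ?_⟩
    rw [entryEval_toDiag, entryEval_toDiag, h j j.lt_succ_self]
  · exact ⟨0, fun d d' _ => (rfl : (dyadic n K : ℂ) = dyadic n K)⟩

lemma exists_out_eq_of_agree {J : Set ℝ} (Γ : GeneralAlgorithm (sourceProblem J))
    (K : singletonWindows J) (d : ℕ → ℂ) :
    ∃ N, ∀ d' : ℕ → ℂ, (∀ j < N, d' j = d j) →
      Γ.out (toDiag d', K) = Γ.out (toDiag d, K) := by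
  have h : ∀ f : diagOperators × singletonWindows J → ℂ, ∃ N, f ∈ Γ.queries (toDiag d, K) →
      ∀ d' : ℕ → ℂ, (∀ j < N, d' j = d j) → f (toDiag d', K) = f (toDiag d, K) := fun f => by
    by_cases hf : f ∈ Γ.queries (toDiag d, K)
    · obtain ⟨N, hN⟩ := exists_eval_eq_of_agree K (Γ.queries_subset _ hf)
      exact ⟨N, fun _ => hN d⟩
    · exact ⟨0, fun h => absurd h hf⟩
  choose N hN using h
  refine ⟨(Γ.queries (toDiag d, K)).sup N, fun d' h => (Γ.determined _ _ fun f hf => ?_).1⟩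
  exact hN f hf d' fun j hj => h j (hj.trans_le (Finset.le_sup hf))

/-- Some diagonal defeats every sequence of general algorithms: the sequence takes the value `1`
infinitely often on an input whose target is `0`. -/
lemma not_hasTowerFor_one_sourceProblem {J : Set ℝ} (hJ : J.Nonempty) :
    ¬ HasTowerFor (sourceProblem J) 1 (sourceProblem J).target := by
  rintro ⟨G, hG, hlim⟩
  obtain ⟨a, ha⟩ := hJ
  let K : singletonWindows J := ⟨{(a : ℂ)}, a, ha, rfl⟩
  let z : ℂ := point K
  -- A state `(d, N, n)` holds a diagonal with a gap at `z`, the length of its frozen prefix, and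
  -- the index of the last algorithm used.
  have step : ∀ s : {s : (ℕ → ℂ) × ℕ × ℕ // ∃ ε > 0, ∀ j, ε ≤ ‖s.1 j - z‖},
      ∃ t : {s : (ℕ → ℂ) × ℕ × ℕ // ∃ ε > 0, ∀ j, ε ≤ ‖s.1 j - z‖},
        s.1.2.1 < t.1.2.1 ∧ s.1.2.2 < t.1.2.2 ∧ (∀ j < s.1.2.1, t.1.1 j = s.1.1 j) ∧
        (t.1.1 s.1.2.1 = z + 1 / ((s.1.2.1 : ℂ) + 1)) ∧
        ∀ d : ℕ → ℂ, (∀ j < t.1.2.1, d j = t.1.1 j) →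
          G t.1.2.2 (toDiag d, K) = (1 : Fin 2) := by
    rintro ⟨⟨d, N, n⟩, ε, hε, hd⟩
    -- The constant tail keeps a positive gap, so the target is 1, while its distance `1 / (N + 1)`
    -- from `z` shrinks as `N` grows.
    let d' : ℕ → ℂ := fun j => if j < N then d j else z + 1 / ((N : ℂ) + 1)
    have hd' : ∃ ε > 0, ∀ j, ε ≤ ‖d' j - z‖ := by
      refine ⟨min ε (1 / ((N : ℝ) + 1)), lt_min hε Nat.one_div_pos_of_nat, fun j => ?_⟩
      by_cases hj : j < N
      · exact (min_le_left _ _).trans (by simpa [d', hj] using hd j)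
      · refine (min_le_right _ _).trans (le_of_eq ?_)
        simp only [d', if_neg hj, add_sub_cancel_left]
        rw [norm_div, norm_one]
        exact_mod_cast congrArg (fun t : ℝ => 1 / t) (Complex.norm_natCast (N + 1)).symm
    have h1 : (sourceProblem J).target (toDiag d', K) = (1 : Fin 2) :=
      (sourceProblem_target_eq_one_iff _).2 (by rwa [diagEntries_toDiag])
    have hev := eventually_eq_of_tendsto (hlim (toDiag d', K))
    obtain ⟨n', hn', hnn'⟩ := (hev.and (eventually_gt_atTop n)).exists
    obtain ⟨Γ, hΓ⟩ := hG n'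
    obtain ⟨N', hN'⟩ := exists_out_eq_of_agree Γ K d'
    -- The new prefix covers the entries determining the answer of algorithm `n'` and also entry
    -- `N`, which must survive in the limit.
    refine ⟨⟨⟨d', max N' (N + 1), n'⟩, hd'⟩, lt_max_of_lt_right N.lt_succ_self, hnn',
      fun j hj => if_pos hj, if_neg (lt_irrefl N), fun c hc => ?_⟩
    rw [← hΓ]
    exact (hN' c fun j hj => hc j (lt_max_of_lt_left hj)).trans
      ((congrFun hΓ _).trans (hn'.trans h1))
  choose next hN hn hagree hval hout using step
  let s : ℕ → {s : (ℕ → ℂ) × ℕ × ℕ // ∃ ε > 0, ∀ j, ε ≤ ‖s.1 j - z‖} := fun k =>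
    next^[k] ⟨(fun _ => z + 1, 0, 0), 1, one_pos, fun _ => by simp⟩
  have hs : ∀ k, s (k + 1) = next (s k) := fun k => Function.iterate_succ_apply' _ _ _
  let N : ℕ → ℕ := fun k => (s k).1.2.1
  have hNmono : StrictMono N := strictMono_nat_of_lt_succ fun k => by
    simpa only [N, hs] using hN (s k)
  have hnmono : StrictMono fun k => (s k).1.2.2 := strictMono_nat_of_lt_succ fun k => by
    simpa only [hs] using hn (s k)
  have hstable : ∀ k l, k ≤ l → ∀ j < N k, (s l).1.1 j = (s k).1.1 j := fun k l hkl => by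
    induction l, hkl using Nat.le_induction with
    | base => exact fun _ _ => rfl
    | succ l hkl ih =>
      intro j hj
      rw [hs, hagree (s l) j (hj.trans_le (hNmono.monotone hkl)), ih j hj]
  -- Strict growth of `N` gives `j < N (j + 1)`, so entry `j` is already frozen at stage `j + 1`.
  let d : ℕ → ℂ := fun j => (s (j + 1)).1.1 j
  have hd : ∀ k, ∀ j < N k, d j = (s k).1.1 j := fun k j hj => by
    rcases le_total (j + 1) k with h | h
    · exact (hstable _ _ h j ((Nat.lt_succ_self j).trans_le (hNmono.id_le _))).symm
    · exact hstable _ _ h j hj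
  have hdN : ∀ k, d (N k) = z + 1 / ((N k : ℂ) + 1) := fun k => by
    rw [hd (k + 1) (N k) (hNmono k.lt_succ_self), hs]
    exact hval (s k)
  have hfreq : ∀ k, G (s (k + 1)).1.2.2 (toDiag d, K) = (1 : Fin 2) := fun k => by
    have h := hout (s k) d
    rw [← hs] at h
    exact h (hd (k + 1))
  -- The answers are eventually the target, and infinitely many are 1, so the target is 1; the
  -- entries `d (N k)` then violate the gap.
  have htarget : (sourceProblem J).target (toDiag d, K) = (1 : Fin 2) := by
    obtain ⟨k, hk⟩ := ((hnmono.tendsto_atTop.comp (tendsto_add_atTop_nat 1)).eventually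
      (eventually_eq_of_tendsto (hlim (toDiag d, K)))).exists
    exact hk.symm.trans (hfreq k)
  obtain ⟨ε, hε, hd'⟩ := (sourceProblem_target_eq_one_iff _).1 htarget
  rw [diagEntries_toDiag] at hd'
  obtain ⟨k, hk⟩ := ((tendsto_one_div_add_atTop_nhds_zero_nat (𝕜 := ℝ)).comp
    hNmono.tendsto_atTop |>.eventually_lt_const hε).exists
  refine (hd' (N k)).not_gt ?_
  rw [hdN]
  change ‖z + 1 / ((N k : ℂ) + 1) - z‖ < ε
  rw [add_sub_cancel_left, norm_div, norm_one]
  have : ‖((N k : ℂ) + 1)‖ = (N k : ℝ) + 1 := by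
    exact_mod_cast Complex.norm_natCast (N k + 1)
  rw [this]
  exact hk

lemma SCIG_sourceProblem {J : Set ℝ} (hJ : J.Nonempty) : SCIG (sourceProblem J) = 2 :=
  SCIG_eq_two (hasTowerFor_two_sourceProblem J) (not_hasTowerFor_one_sourceProblem hJ)

/-! ## Reductions between the source problem and its stabilizations -/

lemma point_mem {J : Set ℝ} (K : singletonWindows J) : point K ∈ J := K.2.choose_spec.1

lemma avoids_directSum {J : Set ℝ} (A : H →ₗ.[ℂ] H) (B : stabilizers J)
    (K : singletonWindows J) : avoids (directSum A B.1) K.1 = avoids A K.1 := by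
  rw [eq_singleton_point K]
  refine avoids_congr (mem_opSpectrum_directSum_iff A fun hz => ?_)
  exact (Set.eq_empty_iff_forall_notMem.1 B.2.2) _ ⟨hz, point K, point_mem K, rfl⟩

/-- The stabilization `A ⊕ B` of a diagonal operator `A`. -/
def stabilize {J : Set ℝ} (B : stabilizers J) (A : diagOperators) : stabilizedOperators B.1 :=
  ⟨directSum A.1 B.1, A.1, A.2, rfl⟩

lemma blockEntryEval_zero_zero {J : Set ℝ} (B : stabilizers J) (A : diagOperators)
    (K : singletonWindows J) (i j : ℕ) :
    blockEntryEval B i 0 j 0 (stabilize B A, K) = entryEval J i j (A, K) := by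
  refine (WithLp.prod_inner_apply _ _).trans ?_
  change inner ℂ (e i) (A.1 ⟨e j, _⟩) + inner ℂ (0 : H) _ = _
  rw [inner_zero_left, add_zero]
  rfl

lemma blockEntryEval_zero_one {J : Set ℝ} (B : stabilizers J) (A : diagOperators)
    (K : singletonWindows J) (i j : ℕ) :
    blockEntryEval B i 0 j 1 (stabilize B A, K) = 0 := by
  refine (WithLp.prod_inner_apply _ _).trans ?_
  change inner ℂ (e i) (A.1 0) + inner ℂ (0 : H) _ = _
  rw [inner_zero_left, add_zero, A.1.map_zero, inner_zero_right]

/-- Pairing with `(0, e i)` sees only the second component, on which `B` alone acts. Comparing two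
arbitrary inputs lets the value at a reference input serve as the constant. -/
lemma blockEntryEval_one {J : Set ℝ} (B : stabilizers J) (A A' : diagOperators)
    (K K' : singletonWindows J) (i j : ℕ) (s : Fin 2) :
    blockEntryEval B i 1 j s (stabilize B A, K) = blockEntryEval B i 1 j s (stabilize B A', K') := by
  refine (WithLp.prod_inner_apply _ _).trans
    (Eq.trans ?_ (WithLp.prod_inner_apply _ _).symm)
  change inner ℂ (0 : H) _ + inner ℂ (e i) (B.1 ⟨(blockBasis j s).snd, _⟩)
    = inner ℂ (0 : H) _ + inner ℂ (e i) (B.1 ⟨(blockBasis j s).snd, _⟩)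
  rw [inner_zero_left, inner_zero_left]

lemma sourceProblem_reduces {J : Set ℝ} (hJ : J.Nonempty) (B : stabilizers J) :
    FQReduces (sourceProblem J) (stabilizedProblem J B) := by
  obtain ⟨a, ha⟩ := hJ
  let x₀ : diagOperators × singletonWindows J := (toDiag 0, ⟨{(a : ℂ)}, a, ha, rfl⟩)
  refine FQReduces.of_single (S := sourceProblem J) (P := stabilizedProblem J B)
    (fun x => (stabilize B x.1, x.2)) id continuous_id
    (fun x => (avoids_directSum x.1.1 B x.2).symm) ?_
  rintro f (⟨i, r, j, s, rfl⟩ | ⟨n, hn, rfl⟩)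
  -- A reduction must use at least one source evaluation; outside the first diagonal block its value
  -- is ignored.
  · refine ⟨entryEval J i j, Or.inl ⟨i, j, rfl⟩, ?_⟩
    match r, s with
    | 0, 0 => exact ⟨id, fun x => blockEntryEval_zero_zero B x.1 x.2 i j⟩
    | 0, 1 => exact ⟨fun _ => 0, fun x => blockEntryEval_zero_one B x.1 x.2 i j⟩
    | 1, s => exact ⟨fun _ => blockEntryEval B i 1 j s (stabilize B x₀.1, x₀.2),
        fun x => blockEntryEval_one B x.1 x₀.1 x.2 x₀.2 i j s⟩
  · exact ⟨windowEval _ J n, Or.inr ⟨n, hn, rfl⟩, id, fun _ => rfl⟩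

lemma stabilizedProblem_reduces {J : Set ℝ} (B : stabilizers J) :
    FQReduces (stabilizedProblem J B) (sourceProblem J) := by
  have h : ∀ T : stabilizedOperators B.1, ∃ A : diagOperators, T = stabilize B A := by
    rintro ⟨_, A, hA, rfl⟩
    exact ⟨⟨A, hA⟩, rfl⟩
  choose E hE using h
  refine FQReduces.of_single (S := stabilizedProblem J B) (P := sourceProblem J)
    (fun x => (E x.1, x.2)) id continuous_id (fun x => ?_) ?_
  · have h := avoids_directSum (E x.1).1 B x.2
    rw [show directSum (E x.1).1 B.1 = x.1.1 from (congrArg Subtype.val (hE x.1)).symm] at h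
    exact h
  · rintro f (⟨i, j, rfl⟩ | ⟨n, hn, rfl⟩)
    · refine ⟨blockEntryEval B i 0 j 0, Or.inl ⟨i, 0, j, 0, rfl⟩, id, fun x => ?_⟩
      have h := blockEntryEval_zero_zero B (E x.1) x.2 i j
      rw [← hE] at h
      exact h.symm
    · exact ⟨windowEval _ J n, Or.inr ⟨n, hn, rfl⟩, id, fun _ => rfl⟩

lemma SCIG_stabilizedProblem {J : Set ℝ} (hJ : J.Nonempty) (B : stabilizers J) :
    SCIG (stabilizedProblem J B) = 2 :=
  (le_antisymm (stabilizedProblem_reduces B).SCIG_le (sourceProblem_reduces hJ B).SCIG_le).trans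
    (SCIG_sourceProblem hJ)

/-- The scalar operator `i` stabilizes every window set, as its spectrum is not real. -/
lemma stabilizers_nonempty (J : Set ℝ) : Nonempty (stabilizers J) := by
  refine ⟨⟨diagOp fun _ => Complex.I, ⟨_, rfl⟩, ?_⟩⟩
  refine Set.eq_empty_iff_forall_notMem.2 ?_
  rintro _ ⟨hz, t, -, rfl⟩
  refine (notMem_opSpectrum_diagOp_iff _ _).2 ⟨1, one_pos, fun _ => ?_⟩ hz
  simpa using Complex.abs_im_le_norm (Complex.I - t)

end SCI

end

theorem mainTheorem12 (a b : ℝ) (hab : a ≤ b) :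
    SCI.SCIG (SCI.sourceProblem (Set.Icc a b)) = 2 ∧
    (∀ B : SCI.stabilizers (Set.Icc a b),
      SCI.FQReduces (SCI.sourceProblem (Set.Icc a b)) (SCI.stabilizedProblem (Set.Icc a b) B) ∧
      SCI.FQReduces (SCI.stabilizedProblem (Set.Icc a b) B) (SCI.sourceProblem (Set.Icc a b)) ∧
      SCI.SCIG (SCI.stabilizedProblem (Set.Icc a b) B) = 2) ∧
    SCI.FamilyPointwiseExact (SCI.stabilizedProblem (Set.Icc a b)) 2 ∧
    SCI.WitnessSpaceSharp (SCI.stabilizedProblem (Set.Icc a b)) 2 ∧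
    SCI.WorstCaseExact (SCI.stabilizedProblem (Set.Icc a b)) 2 := by
  have hJ : (Set.Icc a b).Nonempty := Set.nonempty_Icc.2 hab
  have hS := SCI.SCIG_stabilizedProblem hJ
  obtain ⟨B₀⟩ := SCI.stabilizers_nonempty (Set.Icc a b)
  refine ⟨SCI.SCIG_sourceProblem hJ, fun B => ⟨SCI.sourceProblem_reduces hJ B,
    SCI.stabilizedProblem_reduces B, hS B⟩, hS, ⟨fun B => (hS B).le, B₀, hS B₀⟩, ?_⟩
  -- Over an empty family the supremum would be 0.
  have : Nonempty (SCI.stabilizers (Set.Icc a b)) := ⟨B₀⟩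
  exact (iSup_congr hS).trans ciSup_const
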